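/- **Theorem 2.2 (Congenial holes).** All graphs are finite, undirected and simple. A graph is an *interval graph* if its vertices can be assigned to nonempty closed intervals of the real line such that two distinct vertices are adjacent if and only if their intervals intersect. A set $X$ of vertices of a graph $G$ is a *minimal forbidden set* if the induced subgraph $G[X]$ is not an interval graph, but $G[Y]$ is an interval graph for every proper subset $Y\subsetneq X$. A set $M\subseteq V(G)$ is a *module* of $G$ if all vertices of $M$ have the same neighbours outside $M$; it is *nontrivial* if $1<|M|<|V(G)|$. The graph $G$ is *reduced* if it has no minimal forbidden set of at most $10$ vertices and every nontrivial module of $G$ induces a clique. A *hole* of $G$ is a chordless cycle of $G$ of length at least $4$, which we identify with its vertex set. For $U\subseteq V(G)$, let $N[U]=\bigcup_{v\in U}(N(v)\cup\{v\})$ be its closed neighbourhood. Two holes $H_1$ and $H_2$ of $G$ are *congenial* if $H_1\subseteq N[H_2]$ and $H_2\subseteq N[H_1]$. If $G$ is a reduced graph, then any two holes of $G$ are congenial. -/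

import Mathlib

namespace HolePaper

/-- `G` is an interval graph: its vertices can be assigned (nonempty, closed) intervals of the real
line so that two distinct vertices are adjacent iff their intervals intersect. -/
def IsIntervalGraph {V : Type*} (G : SimpleGraph V) : Prop :=
  ∃ l r : V → ℝ, (∀ v, l v ≤ r v) ∧
    ∀ u v, u ≠ v → (G.Adj u v ↔ (Set.Icc (l u) (r u) ∩ Set.Icc (l v) (r v)).Nonempty)

/-- `X` is a minimal forbidden set: it does not induce an interval graph, but each of its proper
subsets does. -/
def IsMinimalForbidden {V : Type*} (G : SimpleGraph V) (X : Finset V) : Prop :=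
  ¬ IsIntervalGraph (G.induce (X : Set V)) ∧
    ∀ Y : Finset V, Y ⊂ X → IsIntervalGraph (G.induce (Y : Set V))

/-- `G` is prereduced: it has no minimal forbidden set of at most `10` vertices. -/
def IsPrereduced {V : Type*} (G : SimpleGraph V) : Prop :=
  ¬ ∃ X : Finset V, IsMinimalForbidden G X ∧ X.card ≤ 10

/-- `M` is a module: all vertices of `M` have the same neighbours outside `M`. -/
def IsModule {V : Type*} (G : SimpleGraph V) (M : Set V) : Prop :=
  ∀ u ∈ M, ∀ v ∈ M, ∀ x ∉ M, (G.Adj u x ↔ G.Adj v x)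

/-- `M` is a nontrivial module: a module with at least two vertices that is not the whole
vertex set. -/
def IsNontrivialModule {V : Type*} (G : SimpleGraph V) (M : Set V) : Prop :=
  IsModule G M ∧ M.Nontrivial ∧ M ≠ Set.univ

/-- `G` is reduced: it is prereduced and every nontrivial module of it induces a clique. -/
def IsReduced {V : Type*} (G : SimpleGraph V) : Prop :=
  IsPrereduced G ∧ ∀ M : Set V, IsNontrivialModule G M → G.IsClique M

/-- `H` is (the vertex set of) a hole: a chordless cycle of length at least `4`, i.e. an induced
copy of the cycle `C_n` for some `n ≥ 4`. -/
def IsHole {V : Type*} (G : SimpleGraph V) (H : Set V) : Prop :=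
  ∃ n : ℕ, 4 ≤ n ∧ ∃ f : SimpleGraph.cycleGraph n ↪g G, Set.range f = H

/-- The closed neighbourhood `N[U] = ⋃_{v ∈ U} (N(v) ∪ {v})` of a vertex set `U`. -/
def closedNeighborhood {V : Type*} (G : SimpleGraph V) (U : Set V) : Set V :=
  ⋃ v ∈ U, insert v (G.neighborSet v)

/-- The vertex sets `H₁` and `H₂` (of two holes) are congenial: each is contained in the closed
neighbourhood of the other. -/
def Congenial {V : Type*} (G : SimpleGraph V) (H₁ H₂ : Set V) : Prop :=
  H₁ ⊆ closedNeighborhood G H₂ ∧ H₂ ⊆ closedNeighborhood G H₁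

end HolePaper

namespace HolePaper

/-! Fix a hole `H`. A vertex of another hole has two nonadjacent neighbours on that hole, so it is
not simplicial. It therefore suffices that every vertex outside `N[H]` is simplicial
(`simplicial_of_far`). Sets of at most ten vertices induce interval graphs, so `H` has at least
eleven vertices, and small asteroidal triples restrict how a vertex attaches to `H` (`attachment`)
and how vertices off `H` see one another. These local facts yield two modules. One contains `H`, so
it is not a clique and must be everything, which rules out vertices complete to `H`
(`not_complete_of_reduced`). The other is a component of `G - N[H]`, hence a clique; its outside
neighbours are partially attached to `H` and pairwise adjacent (`adj_of_common_far`). -/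

variable {V : Type*} {G : SimpleGraph V}

/-! ### Interval models of small vertex sets -/

/-- A set of at most ten vertices of a prereduced graph has an interval model. -/
theorem IsPrereduced.exists_model (hG : IsPrereduced G) (X : Finset V) (hX : X.card ≤ 10) :
    ∃ l r : V → ℝ, (∀ v, l v ≤ r v) ∧
      ∀ u ∈ X, ∀ v ∈ X, u ≠ v → (G.Adj u v ↔ l u ≤ r v ∧ l v ≤ r u) := by
  have hI : IsIntervalGraph (G.induce (X : Set V)) := by
    induction X using Finset.strongInduction with
    | H X ih =>
      by_contra hX'
      exact hG ⟨X, ⟨hX', fun Y hY => ih Y hY ((Finset.card_le_card hY.subset).trans hX)⟩, hX⟩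
  obtain ⟨l, r, hlr, h⟩ := hI
  -- Off `X` both endpoints default to 0, so `l ≤ r` holds everywhere.
  refine ⟨Function.extend Subtype.val l fun _ => 0, Function.extend Subtype.val r fun _ => 0,
    fun v => ?_, fun u hu v hv huv => ?_⟩
  · by_cases hv : ∃ a : (X : Set V), a.1 = v
    · obtain ⟨a, rfl⟩ := hv
      rw [Subtype.val_injective.extend_apply, Subtype.val_injective.extend_apply]
      exact hlr a
    · rw [Function.extend_apply' _ _ _ hv, Function.extend_apply' _ _ _ hv]
  · have key := h ⟨u, hu⟩ ⟨v, hv⟩ (fun e => huv (congrArg Subtype.val e))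
    have e : ∀ (k : ↥(X : Set V) → ℝ) (x : V) (hx : x ∈ (X : Set V)),
        Function.extend Subtype.val k (fun _ => (0 : ℝ)) x = k ⟨x, hx⟩ := fun k x hx =>
      Subtype.val_injective.extend_apply k _ ⟨x, hx⟩
    rw [e l u hu, e r v hv, e l v hv, e r u hu]
    rw [SimpleGraph.comap_adj] at key
    refine key.trans ?_
    rw [Set.Icc_inter_Icc, Set.nonempty_Icc, sup_le_iff, le_inf_iff, le_inf_iff]
    have := hlr ⟨u, hu⟩
    have := hlr ⟨v, hv⟩
    tauto

/-- A nonempty set of at most ten vertices of a prereduced graph has a simplicial vertex. -/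
theorem IsPrereduced.exists_simplicial (hG : IsPrereduced G) (X : Finset V) (hX : X.card ≤ 10)
    (hne : X.Nonempty) :
    ∃ v ∈ X, ∀ a ∈ X, ∀ b ∈ X, G.Adj v a → G.Adj v b → a ≠ b → G.Adj a b := by
  obtain ⟨l, r, -, h⟩ := hG.exists_model X hX
  -- All neighbours of the interval that ends first contain its right endpoint.
  obtain ⟨v, hv, hmin⟩ := X.exists_min_image r hne
  refine ⟨v, hv, fun a ha b hb hva hvb hab => (h a ha b hb hab).2 ?_⟩
  have h1 := (h v hv a ha hva.ne).1 hva
  have h2 := (h v hv b hb hvb.ne).1 hvb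
  exact ⟨h1.2.trans (hmin b hb), h2.2.trans (hmin a ha)⟩

/-- In an interval model, a path avoiding the neighbourhood of `c` stays on one side of `c`. -/
theorem chain_same_side {X : Finset V} {l r : V → ℝ} (hlr : ∀ v, l v ≤ r v)
    (h : ∀ u ∈ X, ∀ v ∈ X, u ≠ v → (G.Adj u v ↔ l u ≤ r v ∧ l v ≤ r u)) {c : V} (hc : c ∈ X)
    (p : List V) (a b : V) (hp : List.IsChain G.Adj (a :: (p ++ [b])))
    (hX : ∀ v ∈ a :: (p ++ [b]), v ∈ X) (hN : ∀ v ∈ a :: (p ++ [b]), ¬ G.Adj v c) :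
    a ≠ c ∧ b ≠ c ∧ (r a < l c ↔ r b < l c) := by
  have step : ∀ u ∈ X, ∀ v ∈ X, G.Adj u v → ¬ G.Adj u c → ¬ G.Adj v c →
      u ≠ c ∧ v ≠ c ∧ (r u < l c ↔ r v < l c) := by
    intro u hu v hv huv huc hvc
    have h1 : u ≠ c := by rintro rfl; exact hvc huv.symm
    have h2 : v ≠ c := by rintro rfl; exact huc huv
    have e := (h u hu v hv huv.ne).1 huv
    rw [h u hu c hc h1] at huc
    rw [h v hv c hc h2] at hvc
    have := hlr u
    have := hlr v
    have := hlr c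
    refine ⟨h1, h2, fun h3 => ?_, fun h3 => ?_⟩
    · by_contra h4
      exact hvc ⟨by linarith, by linarith⟩
    · by_contra h4
      exact huc ⟨by linarith, by linarith⟩
  induction p generalizing a with
  | nil =>
    simp only [List.nil_append, List.isChain_cons_cons, List.mem_cons, List.not_mem_nil,
      or_false, forall_eq_or_imp, forall_eq] at hp hX hN
    exact step a hX.1 b hX.2 hp.1 hN.1 hN.2
  | cons d p ih =>
    rw [List.cons_append, List.isChain_cons_cons] at hp
    rw [List.cons_append, List.forall_mem_cons] at hX hN
    have h1 := ih d hp.2 hX.2 hN.2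
    have h2 := step a hX.1 d (hX.2 d (by simp)) hp.1 hN.1 (hN.2 d (by simp))
    exact ⟨h2.1, h1.2.1, h2.2.2.trans h1.2.2⟩

/-! ### Small forbidden subgraphs -/

/-- A prereduced graph has no asteroidal triple witnessed by at most ten vertices. -/
theorem IsPrereduced.no_asteroidal_triple (hG : IsPrereduced G) (L : List V) (hL : L.length ≤ 10)
    {a b c : V} (p q s : List V)
    (hp : List.IsChain G.Adj (a :: (p ++ [b]))) (hpL : ∀ v ∈ a :: (p ++ [b]), v ∈ L)
    (hpN : ∀ v ∈ a :: (p ++ [b]), ¬ G.Adj v c)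
    (hq : List.IsChain G.Adj (b :: (q ++ [c]))) (hqL : ∀ v ∈ b :: (q ++ [c]), v ∈ L)
    (hqN : ∀ v ∈ b :: (q ++ [c]), ¬ G.Adj v a)
    (hs : List.IsChain G.Adj (a :: (s ++ [c]))) (hsL : ∀ v ∈ a :: (s ++ [c]), v ∈ L)
    (hsN : ∀ v ∈ a :: (s ++ [c]), ¬ G.Adj v b) : False := by
  classical
  obtain ⟨l, r, hlr, h⟩ := hG.exists_model L.toFinset ((List.toFinset_card_le L).trans hL)
  replace hpL := fun v hv => List.mem_toFinset.2 (hpL v hv)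
  replace hqL := fun v hv => List.mem_toFinset.2 (hqL v hv)
  replace hsL := fun v hv => List.mem_toFinset.2 (hsL v hv)
  have ha := hpL a (by simp)
  have hb := hpL b (by simp)
  have hc := hqL c (by simp)
  obtain ⟨hac, hbc, h1⟩ := chain_same_side hlr h hc p a b hp hpL hpN
  obtain ⟨hba, -, h2⟩ := chain_same_side hlr h ha q b c hq hqL hqN
  obtain ⟨-, -, h3⟩ := chain_same_side hlr h hb s a c hs hsL hsN
  have n1 := hpN a (by simp)
  have n2 := hpN b (by simp)
  have n3 := hqN b (by simp)
  rw [h a ha c hc hac, not_and_or, not_le, not_le] at n1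
  rw [h b hb c hc hbc, not_and_or, not_le, not_le] at n2
  rw [h b hb a ha hba, not_and_or, not_le, not_le] at n3
  have := hlr a
  have := hlr b
  have := hlr c
  have t : ∀ {x y : ℝ}, ¬ x < y → y ≤ x := fun h => not_lt.1 h
  -- Of three disjoint intervals one lies between the other two, although these must be on the same
  -- side of it.
  rcases n1 with n1 | n1 <;> rcases n2 with n2 | n2 <;> rcases n3 with n3 | n3 <;>
    by_cases k1 : r a < l c <;> by_cases k2 : r b < l a <;> by_cases k3 : r a < l b <;>
    first
    | linarith
    | (have e1 := k1; have e2 := k2; have e3 := k3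
       rw [h1] at e1; rw [h2] at e2; rw [h3] at e3
       simp only [not_lt] at k1 k2 k3 e1 e2 e3
       linarith)

/-- The asteroidal triple is `a'`, `b'`, `c'`. Here and in the next three lemmas only the edges of
the three paths and the nonadjacencies to the third vertex matter; other pairs, such as `a` and `b`
here, are left free. -/
theorem IsPrereduced.no_long_claw (hG : IsPrereduced G) {z a a' b b' c c' : V}
    (hza : G.Adj z a) (hzb : G.Adj z b) (hzc : G.Adj z c)
    (ha : G.Adj a a') (hb : G.Adj b b') (hc : G.Adj c c')
    (hza' : ¬ G.Adj z a') (hzb' : ¬ G.Adj z b') (hzc' : ¬ G.Adj z c')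
    (hab' : ¬ G.Adj a b') (hac' : ¬ G.Adj a c') (hba' : ¬ G.Adj b a') (hbc' : ¬ G.Adj b c')
    (hca' : ¬ G.Adj c a') (hcb' : ¬ G.Adj c b')
    (h1 : ¬ G.Adj a' b') (h2 : ¬ G.Adj a' c') (h3 : ¬ G.Adj b' c') : False := by
  have h1' := mt G.adj_symm h1
  have h2' := mt G.adj_symm h2
  have h3' := mt G.adj_symm h3
  refine hG.no_asteroidal_triple [z, a, a', b, b', c, c'] (by simp) (a := a') (b := b') (c := c')
    [a, z, b] [b, z, c] [a, z, c] ?_ ?_ ?_ ?_ ?_ ?_ ?_ ?_ ?_ <;>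
  simp [*, G.adj_comm a' a, G.adj_comm a z, G.adj_comm b z, G.adj_comm b' b]

theorem IsPrereduced.no_net (hG : IsPrereduced G) {a a' b b' c c' : V}
    (hab : G.Adj a b) (hbc : G.Adj b c) (hac : G.Adj a c)
    (ha : G.Adj a a') (hb : G.Adj b b') (hc : G.Adj c c')
    (hab' : ¬ G.Adj a b') (hac' : ¬ G.Adj a c') (hba' : ¬ G.Adj b a') (hbc' : ¬ G.Adj b c')
    (hca' : ¬ G.Adj c a') (hcb' : ¬ G.Adj c b')
    (h1 : ¬ G.Adj a' b') (h2 : ¬ G.Adj a' c') (h3 : ¬ G.Adj b' c') : False := by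
  have h1' := mt G.adj_symm h1
  have h2' := mt G.adj_symm h2
  have h3' := mt G.adj_symm h3
  refine hG.no_asteroidal_triple [a, a', b, b', c, c'] (by simp) (a := a') (b := b') (c := c')
    [a, b] [b, c] [a, c] ?_ ?_ ?_ ?_ ?_ ?_ ?_ ?_ ?_ <;>
  simp [*, G.adj_comm a' a, G.adj_comm b' b]

theorem IsPrereduced.no_tent (hG : IsPrereduced G) {x y z a b c : V}
    (hax : G.Adj a x) (hay : G.Adj a y) (hbx : G.Adj b x) (hbz : G.Adj b z)
    (hcy : G.Adj c y) (hcz : G.Adj c z)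
    (haz : ¬ G.Adj z a) (hby : ¬ G.Adj y b) (hcx : ¬ G.Adj x c)
    (h1 : ¬ G.Adj a b) (h2 : ¬ G.Adj a c) (h3 : ¬ G.Adj b c) : False := by
  have h1' := mt G.adj_symm h1
  have h2' := mt G.adj_symm h2
  have h3' := mt G.adj_symm h3
  refine hG.no_asteroidal_triple [x, y, z, a, b, c] (by simp) (a := a) (b := b) (c := c)
    [x] [z] [y] ?_ ?_ ?_ ?_ ?_ ?_ ?_ ?_ ?_ <;>
  simp [*, G.adj_comm x b, G.adj_comm z c, G.adj_comm y c]

theorem IsPrereduced.no_whipping_top (hG : IsPrereduced G) {u x z a a' b b' : V}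
    (huz : G.Adj u z) (hza : G.Adj z a) (hzb : G.Adj z b) (ha : G.Adj a a') (hb : G.Adj b b')
    (hxa : G.Adj x a') (hxb : G.Adj x b') (hxu : ¬ G.Adj x u)
    (hua : ¬ G.Adj u a') (hub : ¬ G.Adj u b') (hza' : ¬ G.Adj z a') (hzb' : ¬ G.Adj z b')
    (hab : ¬ G.Adj a b') (hba : ¬ G.Adj b a') (h1 : ¬ G.Adj a' b') : False := by
  have h1' := mt G.adj_symm h1
  have hua' := mt G.adj_symm hua
  have hub' := mt G.adj_symm hub
  refine hG.no_asteroidal_triple [u, x, z, a, a', b, b'] (by simp) (a := u) (b := a') (c := b')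
    [z, a] [x] [z, b] ?_ ?_ ?_ ?_ ?_ ?_ ?_ ?_ ?_ <;>
  simp [*, G.adj_comm a' x]

theorem IsPrereduced.no_four_hole (hG : IsPrereduced G) {a b c d : V}
    (hab : G.Adj a b) (hbc : G.Adj b c) (hcd : G.Adj c d) (hda : G.Adj d a)
    (hac : ¬ G.Adj a c) (hbd : ¬ G.Adj b d) (hac' : a ≠ c) (hbd' : b ≠ d) : False := by
  classical
  obtain ⟨v, hv, h⟩ := hG.exists_simplicial [a, b, c, d].toFinset
    ((List.toFinset_card_le _).trans (by simp)) ⟨a, by simp⟩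
  simp only [List.mem_toFinset, List.mem_cons, List.not_mem_nil, or_false] at hv h
  rcases hv with rfl | rfl | rfl | rfl
  · exact hbd (h b (by simp) d (by simp) hab hda.symm hbd')
  · exact hac (h a (by simp) c (by simp) hab.symm hbc hac')
  · exact hbd (h b (by simp) d (by simp) hbc.symm hcd hbd')
  · exact hac (h a (by simp) c (by simp) hda hcd.symm hac')

theorem IsPrereduced.no_five_hole (hG : IsPrereduced G) {a b c d e : V}
    (hab : G.Adj a b) (hbc : G.Adj b c) (hcd : G.Adj c d) (hde : G.Adj d e) (hea : G.Adj e a)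
    (hac : ¬ G.Adj a c) (had : ¬ G.Adj a d) (hbd : ¬ G.Adj b d) (hbe : ¬ G.Adj b e)
    (hce : ¬ G.Adj c e) : False := by
  classical
  obtain ⟨v, hv, h⟩ := hG.exists_simplicial [a, b, c, d, e].toFinset
    ((List.toFinset_card_le _).trans (by simp)) ⟨a, by simp⟩
  simp only [List.mem_toFinset, List.mem_cons, List.not_mem_nil, or_false] at hv h
  rcases hv with rfl | rfl | rfl | rfl | rfl
  · exact hbe (h b (by simp) e (by simp) hab hea.symm (by rintro rfl; exact hce hbc.symm))
  · exact hac (h a (by simp) c (by simp) hab.symm hbc (by rintro rfl; exact had hcd))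
  · exact hbd (h b (by simp) d (by simp) hbc.symm hcd (by rintro rfl; exact hbe hde))
  · exact hce (h c (by simp) e (by simp) hcd.symm hde (by rintro rfl; exact hac hea.symm))
  · exact had (h a (by simp) d (by simp) hea hde.symm (by rintro rfl; exact hac hcd.symm))

/-! ### Holes indexed by the integers -/

/-- `h` winds the integers around a chordless cycle of length `n`. -/
structure IsWinding (G : SimpleGraph V) (n : ℤ) (h : ℤ → V) : Prop where
  eq_iff : ∀ i j, h i = h j ↔ n ∣ i - j
  adj_iff : ∀ i j, G.Adj (h i) (h j) ↔ n ∣ i - j - 1 ∨ n ∣ j - i - 1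

theorem IsHole.exists_winding {H : Set V} (hH : IsHole G H) :
    ∃ (n : ℤ) (h : ℤ → V), 4 ≤ n ∧ IsWinding G n h ∧ Set.range h = H := by
  obtain ⟨n, hn, f, rfl⟩ := hH
  obtain ⟨m, rfl⟩ : ∃ m, n = m + 2 := ⟨n - 2, by omega⟩
  let g : ZMod (m + 2) → V := f
  have hg : Function.Injective g := f.injective
  have hadj : ∀ i j : ZMod (m + 2), G.Adj (g i) (g j) ↔ i - j = 1 ∨ j - i = 1 := fun i j =>
    f.map_adj_iff.trans SimpleGraph.cycleGraph_adj
  refine ⟨(m + 2 : ℕ), fun i => g i, by exact_mod_cast hn, ⟨fun i j => ?_, fun i j => ?_⟩, ?_⟩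
  · rw [hg.eq_iff, ← ZMod.intCast_zmod_eq_zero_iff_dvd, Int.cast_sub, sub_eq_zero]
  · simp only [hadj, ← ZMod.intCast_zmod_eq_zero_iff_dvd, Int.cast_sub, Int.cast_one, sub_eq_zero]
  · exact (ZMod.intCast_surjective).range_comp g

namespace IsWinding

variable {n : ℤ} {h : ℤ → V}

theorem adj_add_one (hh : IsWinding G n h) (i : ℤ) : G.Adj (h i) (h (i + 1)) := by
  rw [hh.adj_iff]
  exact .inr ⟨0, by ring⟩

theorem adj_sub_one (hh : IsWinding G n h) (i : ℤ) : G.Adj (h i) (h (i - 1)) := by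
  rw [hh.adj_iff]
  exact .inl ⟨0, by ring⟩

theorem ne (hh : IsWinding G n h) {i j : ℤ} (hij : 0 < j - i ∧ j - i < n) : h i ≠ h j := by
  intro e
  have := Int.le_of_dvd hij.1 ((hh.eq_iff j i).1 e.symm)
  omega

theorem not_adj (hh : IsWinding G n h) {i j : ℤ} (hij : 1 < j - i ∧ j - i < n - 1) :
    ¬ G.Adj (h i) (h j) := by
  rw [hh.adj_iff]
  rintro (e | e)
  · have := Int.le_of_dvd (by omega) ((dvd_neg).2 e)
    omega
  · have := Int.le_of_dvd (by omega) e
    omega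

theorem not_adj' (hh : IsWinding G n h) {i j : ℤ} (hij : 1 < i - j ∧ i - j < n - 1) :
    ¬ G.Adj (h i) (h j) := fun e => hh.not_adj hij e.symm

/-- A shorter hole would need a simplicial vertex, but the two cycle neighbours of each vertex are
nonadjacent. -/
theorem eleven_le (hG : IsPrereduced G) (hh : IsWinding G n h) (hn : 4 ≤ n) : 11 ≤ n := by
  classical
  by_contra! hn'
  obtain ⟨v, hv, hs⟩ := hG.exists_simplicial ((Finset.Ico 0 n).image h)
    (Finset.card_image_le.trans (by simp; omega)) ⟨h 0, Finset.mem_image_of_mem _ (by simp; omega)⟩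
  have hmem : ∀ i, h i ∈ (Finset.Ico 0 n).image h := fun i => by
    refine Finset.mem_image.2 ⟨i % n, ?_, (hh.eq_iff _ _).2 ?_⟩
    · simpa using ⟨Int.emod_nonneg _ (by omega), Int.emod_lt_of_pos _ (by omega)⟩
    · exact ⟨-(i / n), by linarith [Int.emod_add_mul_ediv i n]⟩
  obtain ⟨i, -, rfl⟩ := Finset.mem_image.1 hv
  exact hh.not_adj (by omega) (hs _ (hmem (i - 1)) _ (hmem (i + 1)) (hh.adj_sub_one i)
    (hh.adj_add_one i) (hh.ne (by omega)))

/-! ### Attachment of vertices to a hole -/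

/-- A vertex outside the cycle with both a neighbour and a nonneighbour on it bounds a gap:
a segment of at least eight consecutive nonneighbours between two neighbours. -/
theorem exists_gap (hG : IsPrereduced G) (hh : IsWinding G n h) (hn : 11 ≤ n) {w : V}
    (hw : ∀ i, w ≠ h i) (hw₁ : ∃ i, G.Adj w (h i)) (hw₂ : ∃ i, ¬ G.Adj w (h i)) :
    ∃ s t : ℤ, s + 9 ≤ t ∧ t ≤ s + n ∧ G.Adj w (h s) ∧ G.Adj w (h t) ∧
      ∀ i, s < i → i < t → ¬ G.Adj w (h i) := by
  classical
  -- Otherwise adjacency to `w` would propagate around the whole cycle.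
  obtain ⟨s, hs, hs'⟩ : ∃ s, G.Adj w (h s) ∧ ¬ G.Adj w (h (s + 1)) := by
    by_contra! hcon
    obtain ⟨i, hi⟩ := hw₁
    obtain ⟨j, hj⟩ := hw₂
    have hk : ∀ k : ℕ, G.Adj w (h (i + k)) := by
      intro k
      induction k with
      | zero => simpa using hi
      | succ k ih => simpa [add_assoc] using hcon _ ih
    apply hj
    have e := hk ((j - i) % n).toNat
    rw [Int.toNat_of_nonneg (Int.emod_nonneg _ (by omega))] at e
    have : h j = h (i + (j - i) % n) := by
      rw [hh.eq_iff]
      have := Int.emod_add_mul_ediv (j - i) n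
      exact ⟨(j - i) / n, by linarith⟩
    rwa [this]
  have hper : h (s + n) = h s := (hh.eq_iff _ _).2 ⟨1, by ring⟩
  have hex : ∃ k : ℕ, G.Adj w (h (s + 1 + k)) :=
    ⟨(n - 1).toNat, by
      rw [Int.toNat_of_nonneg (by omega), show s + 1 + (n - 1) = s + n by ring, hper]; exact hs⟩
  obtain ⟨k, hk, hkmin⟩ : ∃ k : ℕ, G.Adj w (h (s + 1 + k)) ∧
      ∀ j : ℕ, j < k → ¬ G.Adj w (h (s + 1 + j)) :=
    ⟨Nat.find hex, Nat.find_spec hex, fun j hj => Nat.find_min hex hj⟩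
  have hgap : ∀ i, s < i → i < s + 1 + k → ¬ G.Adj w (h i) := by
    intro i h1 h2
    have := hkmin (i - s - 1).toNat (by omega)
    rwa [Int.toNat_of_nonneg (by omega), show s + 1 + (i - s - 1) = i by ring] at this
  have hkn : s + 1 + k ≤ s + n := by
    by_contra! hlt
    exact hgap (s + n) (by omega) hlt (hper ▸ hs)
  have hk0 : k ≠ 0 := by
    rintro rfl
    exact hs' (by simpa using hk)
  obtain ⟨t, ht⟩ : ∃ t : ℤ, t = s + 1 + k := ⟨_, rfl⟩
  rw [← ht] at hk hgap hkn
  refine ⟨s, t, ?_, hkn, hs, hk, hgap⟩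
  -- If `t ≤ s + 8`, the arc from `s` to `t` and `w` form a hole on at most ten vertices, with no
  -- simplicial vertex.
  by_contra! hlt
  obtain ⟨v, hv, hsimp⟩ := hG.exists_simplicial (insert w ((Finset.Icc s t).image h))
    ((Finset.card_insert_le _ _).trans ((Nat.succ_le_succ Finset.card_image_le).trans
      (by simp; omega))) (Finset.insert_nonempty _ _)
  have hmem : ∀ i, s ≤ i → i ≤ t → h i ∈ insert w ((Finset.Icc s t).image h) := fun i h1 h2 =>
    Finset.mem_insert_of_mem (Finset.mem_image_of_mem _ (Finset.mem_Icc.2 ⟨h1, h2⟩))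
  have hmw : w ∈ insert w ((Finset.Icc s t).image h) := Finset.mem_insert_self _ _
  rcases Finset.mem_insert.1 hv with rfl | hv
  · exact hh.not_adj (by omega) (hsimp _ (hmem s le_rfl (by omega)) _ (hmem t (by omega) le_rfl)
      hs hk (hh.ne (by omega)))
  · obtain ⟨i, hi, rfl⟩ := Finset.mem_image.1 hv
    obtain ⟨h1, h2⟩ := Finset.mem_Icc.1 hi
    rcases h1.eq_or_lt with rfl | h1
    · exact hgap (s + 1) (by omega) (by omega) (hsimp _ hmw _ (hmem (s + 1) (by omega) (by omega))
        hs.symm (hh.adj_add_one s) (hw _))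
    rcases h2.eq_or_lt with rfl | h2
    · exact hgap (i - 1) (by omega) (by omega) (hsimp _ hmw _ (hmem (i - 1) (by omega) (by omega))
        hk.symm (hh.adj_sub_one i) (hw _))
    · exact hh.not_adj (by omega) (hsimp _ (hmem (i - 1) (by omega) (by omega)) _
        (hmem (i + 1) (by omega) (by omega)) (hh.adj_sub_one i) (hh.adj_add_one i)
        (hh.ne (by omega)))

/-- How a vertex outside the cycle, neither complete nor anticomplete to it, attaches to it: at a
single vertex, at a single edge, or at both ends of a gap. -/
theorem attachment (hG : IsPrereduced G) (hh : IsWinding G n h) (hn : 11 ≤ n) {w : V}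
    (hw : ∀ i, w ≠ h i) (hw₁ : ∃ i, G.Adj w (h i)) (hw₂ : ∃ i, ¬ G.Adj w (h i)) :
    (∃ s, G.Adj w (h s) ∧ ¬ G.Adj w (h (s - 2)) ∧ ¬ G.Adj w (h (s + 2))) ∨
    (∃ s, G.Adj w (h s) ∧ G.Adj w (h (s + 1)) ∧ ¬ G.Adj w (h (s - 1)) ∧
      ¬ G.Adj w (h (s + 2))) ∨
    (∃ s t, s + 9 ≤ t ∧ t ≤ s + n - 2 ∧ G.Adj w (h s) ∧ G.Adj w (h t) ∧
      ¬ G.Adj w (h (s + 1)) ∧ ¬ G.Adj w (h (t - 1))) := by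
  obtain ⟨s, t, hst, htn, hs, ht, hgap⟩ := hh.exists_gap hG hn hw hw₁ hw₂
  have hper : ∀ i, h i = h (i + n) := fun i => (hh.eq_iff _ _).2 ⟨-1, by ring⟩
  -- A gap of length `n` leaves a single neighbour, and one of length `n - 1` leaves two consecutive
  -- neighbours.
  by_cases h1 : t ≤ s + n - 2
  · exact .inr (.inr ⟨s, t, hst, h1, hs, ht, hgap _ (by omega) (by omega),
      hgap _ (by omega) (by omega)⟩)
  by_cases h2 : t = s + n
  · refine .inl ⟨s, hs, ?_, hgap _ (by omega) (by omega)⟩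
    rw [hper]
    exact hgap _ (by omega) (by omega)
  · obtain rfl : t = s + n - 1 := by omega
    refine .inr (.inl ⟨s - 1, ?_, ?_, ?_, ?_⟩)
    · rwa [hper, show s - 1 + n = s + n - 1 by ring]
    · rwa [sub_add_cancel]
    · rw [hper]
      exact hgap _ (by omega) (by omega)
    · exact hgap _ (by omega) (by omega)

/-- A vertex complete to the cycle is adjacent to every vertex that is partially attached to it. -/
theorem adj_of_complete (hG : IsPrereduced G) (hh : IsWinding G n h) (hn : 11 ≤ n) {x u : V}
    (hx : ∀ i, G.Adj x (h i)) (hu : ∀ i, u ≠ h i) (hu₁ : ∃ i, G.Adj u (h i))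
    (hu₂ : ∃ i, ¬ G.Adj u (h i)) : G.Adj x u := by
  have hxu : x ≠ u := by
    rintro rfl
    exact hu₂.elim fun i hi => hi (hx i)
  by_contra hcon
  -- The three attachments produce a whipping top, a tent and a 4-hole respectively.
  rcases hh.attachment hG hn hu hu₁ hu₂ with
    ⟨s, hs, hm2, hp2⟩ | ⟨s, hs, hs1, hm, hp⟩ | ⟨s, t, hst, htn, hs, ht, -, -⟩
  · have a1 := hh.adj_sub_one (s - 1)
    have a2 := hh.adj_add_one (s + 1)
    rw [show s - 1 - 1 = s - 2 by ring] at a1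
    rw [show s + 1 + 1 = s + 2 by ring] at a2
    exact hG.no_whipping_top hs (hh.adj_sub_one s) (hh.adj_add_one s) a1 a2 (hx _) (hx _) hcon
      hm2 hp2 (hh.not_adj' (by omega)) (hh.not_adj (by omega)) (hh.not_adj (by omega))
      (hh.not_adj' (by omega)) (hh.not_adj (by omega))
  · have a := hh.adj_add_one (s + 1)
    rw [show s + 1 + 1 = s + 2 by ring] at a
    exact hG.no_tent hs hs1 (hh.adj_sub_one s).symm (hx _).symm a.symm
      (hx _).symm hcon (hh.not_adj' (by omega)) (hh.not_adj (by omega)) hm hp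
      (hh.not_adj (by omega))
  · exact hG.no_four_hole hs (hx s).symm (hx t) ht.symm (fun e => hcon e.symm)
      (hh.not_adj (by omega)) hxu.symm (hh.ne (by omega))

/-- If a vertex `w` partially attached to the cycle has a neighbour away from the cycle, then it
attaches to both ends of a gap. -/
theorem attachment_of_adj_far (hG : IsPrereduced G) (hh : IsWinding G n h) (hn : 11 ≤ n)
    {w c : V} (hw₁ : ∃ i, G.Adj w (h i)) (hw₂ : ∃ i, ¬ G.Adj w (h i))
    (hc : ∀ i, ¬ G.Adj c (h i)) (hcw : G.Adj c w) :
    ∃ s t, s + 9 ≤ t ∧ t ≤ s + n - 2 ∧ G.Adj w (h s) ∧ G.Adj w (h t) ∧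
      ¬ G.Adj w (h (s + 1)) ∧ ¬ G.Adj w (h (t - 1)) := by
  have hw : ∀ i, w ≠ h i := by
    rintro i rfl
    exact hc i hcw
  -- A single vertex gives a long claw centred at `h s`; an edge gives a net on the triangle `w`, `h
  -- s`, `h (s + 1)`.
  rcases hh.attachment hG hn hw hw₁ hw₂ with ⟨s, hs, hm2, hp2⟩ | ⟨s, hs, hs1, hm, hp⟩ | h3
  · have a1 := hh.adj_sub_one (s - 1)
    have a2 := hh.adj_add_one (s + 1)
    rw [show s - 1 - 1 = s - 2 by ring] at a1
    rw [show s + 1 + 1 = s + 2 by ring] at a2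
    exact (hG.no_long_claw hs.symm (hh.adj_sub_one s) (hh.adj_add_one s) hcw.symm a1 a2
      (fun e => hc _ e.symm) (hh.not_adj' (by omega)) (hh.not_adj (by omega)) hm2 hp2
      (fun e => hc _ e.symm) (hh.not_adj (by omega)) (fun e => hc _ e.symm)
      (hh.not_adj' (by omega)) (hc _) (hc _) (hh.not_adj (by omega))).elim
  · have a := hh.adj_add_one (s + 1)
    rw [show s + 1 + 1 = s + 2 by ring] at a
    exact (hG.no_net hs (hh.adj_add_one s) hs1 hcw.symm (hh.adj_sub_one s) a hm hp
      (fun e => hc _ e.symm) (hh.not_adj (by omega)) (fun e => hc _ e.symm)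
      (hh.not_adj' (by omega)) (hc _) (hc _) (hh.not_adj (by omega))).elim
  · exact h3

/-- Otherwise `w` centres a long claw: two legs run into the gap from its ends and the third is `c`,
`d`. This makes components of `G - N[H]` modules. -/
theorem adj_far_of_adj_far (hG : IsPrereduced G) (hh : IsWinding G n h) (hn : 11 ≤ n)
    {w c d : V} (hw₁ : ∃ i, G.Adj w (h i)) (hw₂ : ∃ i, ¬ G.Adj w (h i))
    (hc : ∀ i, ¬ G.Adj c (h i)) (hd : ∀ i, ¬ G.Adj d (h i)) (hcw : G.Adj c w)
    (hcd : G.Adj c d) : G.Adj d w := by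
  obtain ⟨s, t, hst, htn, hs, ht, hs', ht'⟩ := hh.attachment_of_adj_far hG hn hw₁ hw₂ hc hcw
  by_contra hcon
  exact hG.no_long_claw hs ht hcw.symm (hh.adj_add_one s) (hh.adj_sub_one t) hcd hs' ht'
    (fun e => hcon e.symm) (hh.not_adj (by omega)) (fun e => hd _ e.symm)
    (hh.not_adj' (by omega)) (fun e => hd _ e.symm) (hc _) (hc _) (hh.not_adj (by omega))
    (fun e => hd _ e.symm) (fun e => hd _ e.symm)

/-- Otherwise `c` and the two vertices just inside the gap form an asteroidal triple: `x` joins the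
latter two, and `w` leads from `c` to each. -/
theorem adj_far_of_complete (hG : IsPrereduced G) (hh : IsWinding G n h) (hn : 11 ≤ n)
    {w c x : V} (hx : ∀ i, G.Adj x (h i)) (hw₁ : ∃ i, G.Adj w (h i))
    (hw₂ : ∃ i, ¬ G.Adj w (h i)) (hc : ∀ i, ¬ G.Adj c (h i)) (hcw : G.Adj c w) : G.Adj x c := by
  obtain ⟨s, t, hst, htn, hs, ht, hs', ht'⟩ := hh.attachment_of_adj_far hG hn hw₁ hw₂ hc hcw
  by_contra hcon
  exact hG.no_whipping_top hcw hs ht (hh.adj_add_one s) (hh.adj_sub_one t) (hx _) (hx _) hcon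
    (hc _) (hc _) hs' ht' (hh.not_adj (by omega)) (hh.not_adj' (by omega))
    (hh.not_adj (by omega))

/-- Two partially attached vertices with a common neighbour away from the cycle are adjacent. -/
theorem adj_of_common_far (hG : IsPrereduced G) (hh : IsWinding G n h) (hn : 11 ≤ n)
    {w w' c : V} (hw₁ : ∃ i, G.Adj w (h i)) (hw₂ : ∃ i, ¬ G.Adj w (h i))
    (hc : ∀ i, ¬ G.Adj c (h i)) (hc' : ∀ i, c ≠ h i) (hcw : G.Adj c w) (hcw' : G.Adj c w')
    (hne : w ≠ w') : G.Adj w w' := by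
  obtain ⟨s, t, hst, htn, hs, ht, hs', ht'⟩ := hh.attachment_of_adj_far hG hn hw₁ hw₂ hc hcw
  by_contra hcon
  -- Excluding 4- and 5-holes through `w`, `c`, `w'` keeps `w'` away from the gap legs, so `c`, `w'`
  -- can be the third leg of a long claw at `w`.
  have four : ∀ i, G.Adj w (h i) → ¬ G.Adj w' (h i) := fun i hi hi' =>
    hG.no_four_hole hcw.symm hcw' hi' hi.symm hcon (hc i) hne (hc' i)
  have five : ∀ i j, G.Adj w (h i) → ¬ G.Adj w (h j) → G.Adj (h i) (h j) → ¬ G.Adj w' (h j) :=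
    fun i j hi hj hij hj' => hG.no_five_hole hcw.symm hcw' hj' hij.symm hi.symm hcon hj (hc j)
      (hc i) (four i hi)
  exact hG.no_long_claw hs ht hcw.symm (hh.adj_add_one s) (hh.adj_sub_one t) hcw' hs' ht' hcon
    (hh.not_adj (by omega)) (fun e => four _ hs e.symm) (hh.not_adj' (by omega))
    (fun e => four _ ht e.symm) (hc _) (hc _) (hh.not_adj (by omega))
    (fun e => five _ _ hs hs' (hh.adj_add_one s) e.symm)
    (fun e => five _ _ ht ht' (hh.adj_sub_one t) e.symm)

/-! ### Modules determined by a hole -/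

/-- In a reduced graph no vertex is complete to a hole. -/
theorem not_complete_of_reduced (hG : IsReduced G) (hh : IsWinding G n h) (hn : 11 ≤ n) (x : V) :
    ∃ i, ¬ G.Adj x (h i) := by
  obtain ⟨hP, hM⟩ := hG
  -- Chosen so that the vertices outside `M` with a neighbour in `M` are exactly those complete to
  -- the hole, and these see all of `M`.
  let M : Set V := {v | (∃ i, ¬ G.Adj v (h i)) ∧ ((∃ i, G.Adj v (h i)) ∨
    ∃ w, G.Adj v w ∧ (∃ i, G.Adj w (h i)) ∧ ∃ i, ¬ G.Adj w (h i))}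
  have hself : ∀ i, h i ∈ M := fun i =>
    ⟨⟨i, G.loopless.irrefl _⟩, .inl ⟨i + 1, hh.adj_add_one i⟩⟩
  have hcompl : ∀ x, (∀ i, G.Adj x (h i)) → ∀ v ∈ M, G.Adj v x := by
    rintro x hx v ⟨hv, hv'⟩
    by_cases hvn : ∃ i, G.Adj v (h i)
    · by_cases hvh : ∃ i, v = h i
      · obtain ⟨i, rfl⟩ := hvh
        exact (hx i).symm
      · push Not at hvh
        exact (hh.adj_of_complete hP hn hx hvh hvn hv).symm
    · obtain ⟨w, hvw, hw₁, hw₂⟩ := hv'.resolve_left hvn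
      push Not at hvn
      exact (hh.adj_far_of_complete hP hn hx hw₁ hw₂ hvn hvw).symm
  have hout : ∀ v ∈ M, ∀ y ∉ M, G.Adj v y → ∀ i, G.Adj y (h i) := by
    rintro v ⟨hv, hv'⟩ y hy hvy
    by_contra! hyc
    have hyn : ¬ ∃ i, G.Adj y (h i) := fun e => hy ⟨hyc, .inl e⟩
    by_cases hvn : ∃ i, G.Adj v (h i)
    · exact hy ⟨hyc, .inr ⟨v, hvy.symm, hvn, hv⟩⟩
    · obtain ⟨w, hvw, hw₁, hw₂⟩ := hv'.resolve_left hvn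
      push Not at hvn
      exact hy ⟨hyc, .inr ⟨w, hh.adj_far_of_adj_far hP hn hw₁ hw₂ hvn (not_exists.1 hyn) hvw hvy,
        hw₁, hw₂⟩⟩
  have huniv : M = Set.univ := by
    by_contra hne
    have hclique := hM M ⟨fun u hu v hv y hy =>
      ⟨fun e => hcompl y (hout u hu y hy e) v hv, fun e => hcompl y (hout v hv y hy e) u hu⟩,
      ⟨h 0, hself 0, h 2, hself 2, hh.ne (by omega)⟩, hne⟩
    exact hh.not_adj (by omega) (hclique (hself 0) (hself 2) (hh.ne (by omega)))
  exact (huniv ▸ Set.mem_univ x : x ∈ M).1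

/-- In a reduced graph every vertex outside the closed neighbourhood of a hole is simplicial. -/
theorem simplicial_of_far (hG : IsReduced G) (hh : IsWinding G n h) (hn : 11 ≤ n) {u a b : V}
    (hu : ∀ i, ¬ G.Adj u (h i)) (ha : G.Adj u a) (hb : G.Adj u b) (hab : a ≠ b) :
    G.Adj a b := by
  have hnc := hh.not_complete_of_reduced hG hn
  have hfar : ∀ c, (∀ i, ¬ G.Adj c (h i)) → ∀ i, c ≠ h i := by
    rintro c hc i rfl
    exact hc _ (hh.adj_add_one i)
  -- The component of `u` in `G - N[H]`: a vertex with no neighbour on the hole is not on it either.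
  let C : Set V := {v | Relation.ReflTransGen (fun x y => G.Adj x y ∧ ∀ i, ¬ G.Adj y (h i)) u v}
  have huC : u ∈ C := Relation.ReflTransGen.refl
  have hCfar : ∀ v ∈ C, ∀ i, ¬ G.Adj v (h i) := by
    intro v hv
    rcases Relation.ReflTransGen.cases_tail hv with e | ⟨y, -, hy⟩
    · exact e ▸ hu
    · exact hy.2
  have hstep : ∀ v ∈ C, ∀ y, G.Adj v y → y ∉ C → ∃ i, G.Adj y (h i) := by
    intro v hv y hvy hy
    by_contra! e
    exact hy (Relation.ReflTransGen.tail hv ⟨hvy, e⟩)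
  have hback : ∀ v ∈ C, ∀ y, (∃ i, G.Adj y (h i)) → (G.Adj v y ↔ G.Adj u y) := by
    intro v hv y hy
    induction hv with
    | refl => rfl
    | @tail v z hv hz ih =>
      have hvf := hCfar v hv
      rw [← ih]
      refine ⟨fun e => hh.adj_far_of_adj_far hG.1 hn hy (hnc y) hz.2 hvf e hz.1.symm,
        fun e => hh.adj_far_of_adj_far hG.1 hn hy (hnc y) hvf hz.2 e hz.1⟩
  have hmod : IsModule G C := by
    have key : ∀ v ∈ C, ∀ v' ∈ C, ∀ y ∉ C, G.Adj v y → G.Adj v' y := by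
      intro v hv v' hv' y hy e
      have hyn := hstep v hv y e hy
      exact (hback v' hv' y hyn).2 ((hback v hv y hyn).1 e)
    exact fun v hv v' hv' y hy => ⟨key v hv v' hv' y hy, key v' hv' v hv y hy⟩
  have hCuniv : C ≠ Set.univ := fun e =>
    hCfar (h 0) (e ▸ Set.mem_univ _) _ (hh.adj_add_one 0)
  by_cases haC : a ∈ C
  · by_cases hbC : b ∈ C
    · exact hG.2 C ⟨hmod, ⟨a, haC, b, hbC, hab⟩, hCuniv⟩ haC hbC hab
    · exact (hmod u huC a haC b hbC).1 hb
  · have han := hstep u huC a ha haC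
    by_cases hbC : b ∈ C
    · exact ((hmod u huC b hbC a haC).1 ha).symm
    · exact hh.adj_of_common_far hG.1 hn han (hnc a) hu (hfar u hu) ha hb hab

end IsWinding

/-! ### Congeniality -/

theorem IsHole.subset_closedNeighborhood (hG : IsReduced G) {H₁ H₂ : Set V} (h₁ : IsHole G H₁)
    (h₂ : IsHole G H₂) : H₁ ⊆ closedNeighborhood G H₂ := by
  obtain ⟨m, f, hm, hf, rfl⟩ := h₁.exists_winding
  obtain ⟨n, h, hn, hh, rfl⟩ := h₂.exists_winding
  rintro _ ⟨j, rfl⟩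
  by_contra hcon
  have hfar : ∀ i, ¬ G.Adj (f j) (h i) := fun i e =>
    hcon (Set.mem_iUnion₂.2 ⟨h i, ⟨i, rfl⟩, .inr e.symm⟩)
  exact hf.not_adj (by omega) (hh.simplicial_of_far hG (hh.eleven_le hG.1 hn) hfar
    (hf.adj_sub_one j) (hf.adj_add_one j) (hf.ne (by omega)))

end HolePaper

theorem theorem2p2 {V : Type*} [Finite V] (G : SimpleGraph V) (hG : HolePaper.IsReduced G)
    (H₁ H₂ : Set V) (h₁ : HolePaper.IsHole G H₁) (h₂ : HolePaper.IsHole G H₂) :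
    HolePaper.Congenial G H₁ H₂ :=
  ⟨h₁.subset_closedNeighborhood hG h₂, h₂.subset_closedNeighborhood hG h₁⟩
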